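/- \textbf{Setting.} Let $k\ge 1$ and let $G$ be a directed graph (parallel edges allowed) with finite edge set $E$ and two distinct vertices $s,t$ such that $G$ has $k+1$ edge-disjoint $s$-$t$ paths (paths have no repeated vertices). In the $k$-paths system $\mathcal F\subseteq 2^E$ the agents are the edges, and a set of edges is feasible if it contains $k$ edge-disjoint $s$-$t$ paths. Costs and bids are nonnegative reals. For a vector $x$ and a finite set $S$ of edges write $x(S)=\sum_{e\in S}x(e)$. \textbf{Eigenvalues.} Let $\mathcal G^{k+1}$ be the set of all $G^*\subseteq E$ that are unions of $k+1$ edge-disjoint $s$-$t$ paths of $G$. The dependency graph $\mathcal H(G^*)$ has vertex set $G^*$, and distinct $e,e'\in G^*$ are adjacent if and only if every feasible $T\subseteq G^*$ contains $e$ or $e'$. Let $\alpha(G^*)$ be the maximum, over the connected components $\mathcal H_j$ of $\mathcal H(G^*)$, of the largest eigenvalue $\alpha_j$ of the adjacency matrix of $\mathcal H_j$, and let $\alpha_{k+1}=\max\{\alpha(G^*) : G^*\in\mathcal G^{k+1}\}$. \textbf{Mechanism.} Given a bid vector $b$, the Pruning-Lifting $k$-Paths Mechanism proceeds as follows, where ties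 are broken by an arbitrary rule. (i) Pruning: keep a set $G^*=G^*(b)\in\mathcal G^{k+1}$ that minimizes $b(G^*)$. (ii) Lifting: assign to the edges of $G^*$ positive weights $w(e)$, depending only on $G^*$, whose restriction to every component $\mathcal H_j$ of $\mathcal H(G^*)$ is an eigenvector of the adjacency matrix of $\mathcal H_j$ for its largest eigenvalue $\alpha_j$. (iii) Winner selection: choose a feasible $S\subseteq G^*$ that minimizes $\sum_{e\in S}b(e)/w(e)$. (iv) Payment: each $e\in S$ is paid $\min\{t_1(e),t_2(e)\}$, and every other agent is paid $0$. Here $t_1(e)$ is the infimum of the bids of $e$ for which $e$ is dropped in the pruning step, the other bids being fixed ($t_1(e)=+\infty$ if there are none), and $t_2(e)$ is the supremum of the bids of $e$ for which $e$ is selected in step (iii), the set $G^*$ and the other bids being fixed. Let $p(c)$ be the total payment on the bid vector $c$. \textbf{Benchmark.} For a cost vector $c$ and a feasible set $S$ of minimum cost $c(S)$, let $\nu(c)$ be the minimum of $b(S)$ over all vectors $b$ such that (1) $b(e)\ge c(e)$ for all $e\in E$; (2) $b(S\setminus T)\le c(T\setminus S)$ for all $T\in\mathcal F$; (3) for every $e\in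 S$ there is a $T\in\mathcal F$ with $e\notin T$ and $b(S\setminus T)=c(T\setminus S)$. The frugality ratio of the mechanism is $\sup_c p(c)/\nu(c)$ (with $0/0=0$, and $x/0=+\infty$ for $x>0$). \textbf{Theorem.} The frugality ratio of the Pruning-Lifting $k$-Paths Mechanism is at most $$\alpha_{k+1}\cdot\frac{k+1}{k}.$$ This holds for every choice of the tie-breaking rules, of the normalization of the eigenvectors, and of the minimum-cost feasible set $S$ in the definition of $\nu(c)$. -/

import Mathlib

open scoped NNReal ENNReal

/-! ## Set systems, mechanisms, the benchmark `ν` and the frugality ratio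

A set system on a finite set `E` of agents is given by its family `F : Set (Finset E)` of
feasible sets. Costs and bids are nonnegative reals. -/

/-- A mechanism maps a bid vector to a set of winners and a payment for every agent. Payments
are `ℝ≥0∞`-valued, since an agent without competition has an infinite threshold. -/
structure Mechanism (E : Type*) where
  winners : (E → ℝ≥0) → Finset E
  payment : (E → ℝ≥0) → E → ℝ≥0∞

/-- The total payment on the vector `c` (under truthful bidding, bids are the costs). -/
noncomputable def Mechanism.totalPayment {E : Type*} [Fintype E] (M : Mechanism E)
    (c : E → ℝ≥0) : ℝ≥0∞ :=
  ∑ e, M.payment c e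

/-- `S` is a feasible set of minimum total cost with respect to `c`. -/
def IsCheapest {E : Type*} (F : Set (Finset E)) (c : E → ℝ≥0) (S : Finset E) : Prop :=
  S ∈ F ∧ ∀ T ∈ F, ∑ e ∈ S, c e ≤ ∑ e ∈ T, c e

/-- The constraints (1), (2), (3) on the bid vector `b` in the program defining `ν(c)`, where `S`
is the given feasible set of minimum total cost. -/
structure NuConstraints {E : Type*} [DecidableEq E] (F : Set (Finset E)) (c : E → ℝ≥0)
    (S : Finset E) (b : E → ℝ≥0) : Prop where
  cost_le : ∀ e, c e ≤ b e
  no_cheaper : ∀ T ∈ F, ∑ e ∈ S \ T, b e ≤ ∑ e ∈ T \ S, c e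
  tight : ∀ e ∈ S, ∃ T ∈ F, e ∉ T ∧ ∑ e' ∈ S \ T, b e' = ∑ e' ∈ T \ S, c e'

/-- The benchmark `ν(c)`, relative to the cheapest feasible set `S`: the least value of
`∑ e ∈ S, b e` subject to the constraints. -/
noncomputable def nu {E : Type*} [DecidableEq E] (F : Set (Finset E)) (c : E → ℝ≥0)
    (S : Finset E) : ℝ≥0∞ :=
  ⨅ (b : E → ℝ≥0) (_ : NuConstraints F c S b), ((∑ e ∈ S, b e : ℝ≥0) : ℝ≥0∞)

/-- The frugality ratio: the supremum over all cost vectors `c` of the total payment divided by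
`ν(c)`. If there are several cheapest feasible sets `S`, the worst one counts. In `ℝ≥0∞` one has
`0 / 0 = 0` and `x / 0 = ∞` for `x > 0`. -/
noncomputable def frugalityRatio {E : Type*} [Fintype E] [DecidableEq E] (F : Set (Finset E))
    (M : Mechanism E) : ℝ≥0∞ :=
  ⨆ (c : E → ℝ≥0) (S : Finset E) (_ : IsCheapest F c S), M.totalPayment c / nu F c S

/-! ## The lifting step: dependency graph, eigenvalues, weights -/

/-- The dependency graph of the set `Es` of surviving agents: two agents are joined when every
feasible set contained in `Es` contains one of them. -/
def dependencyGraph {E : Type*} (F : Set (Finset E)) (Es : Finset E) :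
    SimpleGraph {e : E // e ∈ Es} where
  Adj e e' := e ≠ e' ∧ ∀ T ∈ F, T ⊆ Es → (e : E) ∈ T ∨ (e' : E) ∈ T
  symm := ⟨fun _ _ h => ⟨h.1.symm, fun T hT hTE => (h.2 T hT hTE).symm⟩⟩
  loopless := ⟨fun _ h => h.1 rfl⟩

open Classical in
/-- The adjacency matrix of a connected component of a finite graph. -/
noncomputable def componentMatrix {W : Type*} [Fintype W] {H : SimpleGraph W}
    (C : H.ConnectedComponent) : Matrix C.supp C.supp ℝ :=
  (H.induce C.supp).adjMatrix ℝ

open Classical in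
/-- The largest eigenvalue of the adjacency matrix of a connected component. -/
noncomputable def componentEigenvalue {W : Type*} [Fintype W] {H : SimpleGraph W}
    (C : H.ConnectedComponent) : ℝ :=
  sSup {μ : ℝ | Module.End.HasEigenvalue (Matrix.toLin' (componentMatrix C)) μ}

/-- The maximum of the largest eigenvalues of the connected components. -/
noncomputable def graphEigenvalue {W : Type*} [Fintype W] (H : SimpleGraph W) : ℝ :=
  ⨆ C : H.ConnectedComponent, componentEigenvalue C

open Classical in
/-- `y` is an eigenvector of the adjacency matrix of the component `C`, for its largest
eigenvalue, with positive coordinates. -/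
def IsPositiveEigenvector {W : Type*} [Fintype W] {H : SimpleGraph W}
    (C : H.ConnectedComponent) (y : C.supp → ℝ) : Prop :=
  (∀ v, 0 < y v) ∧ (componentMatrix C).mulVec y = componentEigenvalue C • y

/-- `w` assigns to the surviving agents positive weights which, on every connected component of
the dependency graph, form an eigenvector for the largest eigenvalue of that component. -/
def IsLiftingWeight {E : Type*} (F : Set (Finset E)) (Es : Finset E) (w : E → ℝ) : Prop :=
  ∀ C : (dependencyGraph F Es).ConnectedComponent,
    IsPositiveEigenvector C fun v => w (v : {e : E // e ∈ Es})

/-- The total scaled bid `∑ e ∈ S, b e / w e`. -/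
noncomputable def scaledBid {E : Type*} (w : E → ℝ) (b : E → ℝ≥0) (S : Finset E) : ℝ :=
  ∑ e ∈ S, (b e : ℝ) / w e

/-! ## `k`-paths systems -/

/-- A directed graph with vertex set `V` and edge set `E`; parallel edges and loops are allowed. -/
structure DiMultigraph (V E : Type*) where
  src : E → V
  tgt : E → V

namespace DiMultigraph

variable {V E : Type*}

/-- The list of edges `p` is a directed walk from `u` to `v`. -/
def IsWalk (G : DiMultigraph V E) (v : V) : V → List E → Prop
  | u, [] => u = v
  | u, e :: p => G.src e = u ∧ IsWalk G v (G.tgt e) p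

/-- The list of edges `p` is a directed path from `s` to `t` (without repeated vertices). -/
def IsPath (G : DiMultigraph V E) (s t : V) (p : List E) : Prop :=
  G.IsWalk t s p ∧ (s :: p.map G.tgt).Nodup

/-- `P 0, …, P (n - 1)` are `n` edge-disjoint paths from `s` to `t`. -/
def EdgeDisjointPaths (G : DiMultigraph V E) (s t : V) {n : ℕ} (P : Fin n → List E) : Prop :=
  (∀ i, G.IsPath s t (P i)) ∧ Pairwise fun i j => List.Disjoint (P i) (P j)

/-- The feasible sets of the `k`-paths system: the edge sets which contain `k` edge-disjoint
paths from `s` to `t`. -/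
def kPathsSystem (G : DiMultigraph V E) (s t : V) (k : ℕ) : Set (Finset E) :=
  {T | ∃ P : Fin k → List E, G.EdgeDisjointPaths s t P ∧ ∀ i, ∀ e ∈ P i, e ∈ T}

/-- The edge sets of the subgraphs that are unions of `n` edge-disjoint paths from `s` to `t`. -/
def pathUnions (G : DiMultigraph V E) (s t : V) (n : ℕ) : Set (Finset E) :=
  {Es | ∃ P : Fin n → List E, G.EdgeDisjointPaths s t P ∧ ∀ e, e ∈ Es ↔ ∃ i, e ∈ P i}

/-- `α_{k+1}`: the maximum of `α(G*)` over all unions `G*` of `k + 1` edge-disjoint paths, where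
`α(G*)` is computed from the dependency graph of `G*` for the `k`-paths system. -/
noncomputable def alphaSucc (G : DiMultigraph V E) (s t : V) (k : ℕ) : ℝ :=
  ⨆ Es : G.pathUnions s t (k + 1), graphEigenvalue (dependencyGraph (G.kPathsSystem s t k) Es.1)

end DiMultigraph

/-- The choices that make up an implementation of the Pruning-Lifting `k`-Paths Mechanism:
which of the cheapest unions of `k + 1` edge-disjoint paths survives, how the eigenvectors are
normalized, and which of the cheapest feasible sets with respect to the scaled bids wins. Ties may
be broken in any way. -/
structure PruningLiftingKPaths {V E : Type*} (G : DiMultigraph V E) (s t : V) (k : ℕ) where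
  /-- the surviving edges for a given bid vector -/
  prune : (E → ℝ≥0) → Finset E
  prune_mem : ∀ b, prune b ∈ G.pathUnions s t (k + 1)
  prune_min : ∀ b, ∀ Es ∈ G.pathUnions s t (k + 1), ∑ e ∈ prune b, b e ≤ ∑ e ∈ Es, b e
  /-- the weights for a given set of surviving edges -/
  weight : Finset E → E → ℝ
  weight_spec : ∀ Es ∈ G.pathUnions s t (k + 1),
    IsLiftingWeight (G.kPathsSystem s t k) Es (weight Es)
  /-- the winning set for a given set of surviving edges and a given bid vector -/
  select : Finset E → (E → ℝ≥0) → Finset E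
  select_mem : ∀ Es ∈ G.pathUnions s t (k + 1), ∀ b,
    select Es b ∈ G.kPathsSystem s t k ∧ select Es b ⊆ Es
  select_min : ∀ Es ∈ G.pathUnions s t (k + 1), ∀ b, ∀ T ∈ G.kPathsSystem s t k, T ⊆ Es →
    scaledBid (weight Es) b (select Es b) ≤ scaledBid (weight Es) b T

namespace PruningLiftingKPaths

variable {V E : Type*} [DecidableEq E] {G : DiMultigraph V E} {s t : V} {k : ℕ}

/-- The pruning threshold `t₁(e)`: the infimum of the bids with which `e` is dropped, the other
bids being fixed (`∞` if `e` is never dropped). -/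
noncomputable def pruneThreshold (M : PruningLiftingKPaths G s t k) (b : E → ℝ≥0) (e : E) :
    ℝ≥0∞ :=
  ⨅ (x : ℝ≥0) (_ : e ∉ M.prune (Function.update b e x)), (x : ℝ≥0∞)

/-- The selection threshold `t₂(e)`: the supremum of the bids with which `e` is selected in the
winner selection stage, the surviving set and the other bids being fixed. -/
noncomputable def selectThreshold (M : PruningLiftingKPaths G s t k) (b : E → ℝ≥0) (e : E) :
    ℝ≥0∞ :=
  ⨆ (x : ℝ≥0) (_ : e ∈ M.select (M.prune b) (Function.update b e x)), (x : ℝ≥0∞)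

/-- The mechanism: winners are selected from the pruned system, and each winner is paid the
smaller one of the two thresholds. -/
noncomputable def toMechanism (M : PruningLiftingKPaths G s t k) : Mechanism E where
  winners b := M.select (M.prune b) b
  payment b e :=
    if e ∈ M.select (M.prune b) b then min (M.pruneThreshold b e) (M.selectThreshold b e) else 0

end PruningLiftingKPaths

open Classical in
/-- The largest eigenvalue of a connected component has an eigenvector with positive
coordinates, so that the lifting step can be carried out. -/
theorem exists_component_weight {W : Type*} [Fintype W] {H : SimpleGraph W}
    (C : H.ConnectedComponent) : ∃ y : C.supp → ℝ, IsPositiveEigenvector C y := by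
  set A := componentMatrix C with hA
  have hconn : (H.induce C.supp).Connected := C.connected_toSimpleGraph
  have : Nonempty C.supp := hconn.nonempty
  have hherm : A.IsHermitian := by
    rw [Matrix.IsHermitian, Matrix.conjTranspose_eq_transpose_of_trivial]
    exact SimpleGraph.transpose_adjMatrix _
  have hApos : ∀ i j, 0 ≤ A i j := by
    intro i j
    simp only [hA, componentMatrix, SimpleGraph.adjMatrix_apply]
    split_ifs <;> norm_num
  set s : Set ℝ := {μ : ℝ | Module.End.HasEigenvalue (Matrix.toLin' A) μ} with hs
  have hfin : s.Finite := Module.End.finite_hasEigenvalue _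
  have hev : ∀ μ : ℝ, ∀ x : C.supp → ℝ, x ≠ 0 → A.mulVec x = μ • x → μ ∈ s := by
    intro μ x hx h
    exact Module.End.hasEigenvalue_of_hasEigenvector (x := x)
      ⟨Module.End.mem_eigenspace_iff.2 (by simpa using h), hx⟩
  have hne : s.Nonempty := by
    obtain ⟨i⟩ := ‹Nonempty C.supp›
    refine ⟨hherm.eigenvalues i, hev _ (hherm.eigenvectorBasis i).ofLp ?_
      (hherm.mulVec_eigenvectorBasis i)⟩
    intro h
    have := hherm.eigenvectorBasis.orthonormal.ne_zero i
    exact this (by ext j; exact congrFun h j)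
  set l := componentEigenvalue C with hl
  have hmem : l ∈ s := hne.csSup_mem hfin
  have hmax : ∀ μ ∈ s, μ ≤ l := fun μ h => le_csSup hfin.bddAbove h
  obtain ⟨x, hx⟩ := hmem.exists_hasEigenvector
  have hx0 : x ≠ 0 := hx.2
  have hxA : A.mulVec x = l • x := by simpa using hx.apply_eq_smul
  have hB : (l • (1 : Matrix C.supp C.supp ℝ) - A).IsHermitian :=
    (Matrix.isHermitian_one.smul (k := l) (IsSelfAdjoint.all l)).sub hherm
  have hpsd : (l • (1 : Matrix C.supp C.supp ℝ) - A).PosSemidef := by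
    rw [hB.posSemidef_iff_eigenvalues_nonneg]
    intro i
    have h := hB.mulVec_eigenvectorBasis i
    rw [Matrix.sub_mulVec, Matrix.smul_mulVec, Matrix.one_mulVec] at h
    have h2 : A.mulVec (hB.eigenvectorBasis i).ofLp =
        (l - hB.eigenvalues i) • (hB.eigenvectorBasis i).ofLp := by
      rw [sub_smul, ← h]; abel
    have h3 := hmax _ (hev _ _ (by
      intro h
      exact hB.eigenvectorBasis.orthonormal.ne_zero i (by ext j; exact congrFun h j)) h2)
    simp only [Pi.zero_apply]
    linarith
  set y : C.supp → ℝ := fun v => |x v| with hy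
  have hyA : A.mulVec y = l • y := by
    have h0 : star y ⬝ᵥ (l • (1 : Matrix C.supp C.supp ℝ) - A).mulVec y = 0 := by
      apply le_antisymm _ (hpsd.dotProduct_mulVec_nonneg y)
      have hx1 : x ⬝ᵥ A.mulVec x = l * (x ⬝ᵥ x) := by
        rw [hxA, dotProduct_smul, smul_eq_mul]
      have hxy : y ⬝ᵥ y = x ⬝ᵥ x := by simp [dotProduct, hy]
      have hle : x ⬝ᵥ A.mulVec x ≤ y ⬝ᵥ A.mulVec y := by
        simp only [dotProduct, Matrix.mulVec, Finset.mul_sum]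
        refine Finset.sum_le_sum fun i _ => Finset.sum_le_sum fun j _ => ?_
        calc x i * (A i j * x j) ≤ |x i * (A i j * x j)| := le_abs_self _
          _ = y i * (A i j * y j) := by rw [abs_mul, abs_mul, abs_of_nonneg (hApos i j)]
      rw [Matrix.sub_mulVec, Matrix.smul_mulVec, Matrix.one_mulVec, dotProduct_sub,
        dotProduct_smul, smul_eq_mul, star_trivial, hxy]
      linarith
    have := (hpsd.dotProduct_mulVec_zero_iff y).1 h0
    rw [Matrix.sub_mulVec, Matrix.smul_mulVec, Matrix.one_mulVec, sub_eq_zero] at this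
    exact this.symm
  have hy0 : ∀ v, 0 ≤ y v := fun v => abs_nonneg _
  refine ⟨y, fun v => lt_of_le_of_ne (hy0 v) fun hv => hx0 ?_, hyA⟩
  have hstep : ∀ a b, (H.induce C.supp).Adj a b → y a = 0 → y b = 0 := by
    intro a b hab ha
    have h := congrFun hyA a
    simp only [Matrix.mulVec, dotProduct, Pi.smul_apply, ha, smul_zero] at h
    have h2 := (Finset.sum_eq_zero_iff_of_nonneg
      (fun i _ => mul_nonneg (hApos a i) (hy0 i))).1 h b (Finset.mem_univ _)
    have h3 : A a b = 1 := by
      simp only [hA, componentMatrix, SimpleGraph.adjMatrix_apply, if_pos hab]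
    simpa [h3] using h2
  have hwalk : ∀ a b, (H.induce C.supp).Walk a b → y a = 0 → y b = 0 := by
    intro a b p
    induction p with
    | nil => exact id
    | cons h _ ih => exact fun ha => ih (hstep _ _ h ha)
  ext u
  obtain ⟨p⟩ := hconn.preconnected v u
  simpa [hy] using hwalk v u p hv.symm

/-- Lifting weights exist. -/
theorem exists_isLiftingWeight {E : Type*} (F : Set (Finset E)) (Es : Finset E) :
    ∃ w : E → ℝ, IsLiftingWeight F Es w := by
  classical
  choose y hy using fun C : (dependencyGraph F Es).ConnectedComponent =>
    exists_component_weight C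
  let w : E → ℝ := fun e => if h : e ∈ Es then
    y ((dependencyGraph F Es).connectedComponentMk ⟨e, h⟩) ⟨⟨e, h⟩, rfl⟩ else 1
  have hw : ∀ C : (dependencyGraph F Es).ConnectedComponent,
      (fun v : C.supp => w (v : {e : E // e ∈ Es})) = y C := by
    intro C
    ext ⟨⟨e, he⟩, hv⟩
    have hC : (dependencyGraph F Es).connectedComponentMk ⟨e, he⟩ = C := hv
    subst hC
    simp [w, he]
  refine ⟨w, fun C => ?_⟩
  rw [hw C]
  exact hy C

/-- The mechanism can be implemented whenever there are `k + 1` edge-disjoint paths. -/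
theorem PruningLiftingKPaths.nonempty {V E : Type*} [Finite E] (G : DiMultigraph V E)
    (s t : V) (k : ℕ) (h : (G.pathUnions s t (k + 1)).Nonempty) :
    Nonempty (PruningLiftingKPaths G s t k) := by
  have hsub : ∀ Es ∈ G.pathUnions s t (k + 1),
      ∃ T ∈ G.kPathsSystem s t k, T ⊆ Es := by
    rintro Es ⟨P, hP, hE⟩
    exact ⟨Es, ⟨fun i => P i.castSucc, ⟨fun i => hP.1 _, fun i j hij =>
      hP.2 (fun h => hij (Fin.castSucc_injective _ h))⟩, fun i e he => (hE e).2 ⟨_, he⟩⟩,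
      subset_rfl⟩
  have h1 : ∀ b : E → ℝ≥0, ∃ Es ∈ G.pathUnions s t (k + 1),
      ∀ Es' ∈ G.pathUnions s t (k + 1), ∑ e ∈ Es, b e ≤ ∑ e ∈ Es', b e := fun b =>
    Set.exists_min_image _ (fun Es : Finset E => ∑ e ∈ Es, b e) (Set.toFinite _) h
  choose pr hpr hpr' using h1
  choose w hw using fun Es => exists_isLiftingWeight (G.kPathsSystem s t k) Es
  have h2 : ∀ (Es : Finset E) (b : E → ℝ≥0), ∃ S : Finset E, Es ∈ G.pathUnions s t (k + 1) →
      (S ∈ G.kPathsSystem s t k ∧ S ⊆ Es) ∧ ∀ T ∈ G.kPathsSystem s t k, T ⊆ Es →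
        scaledBid (w Es) b S ≤ scaledBid (w Es) b T := by
    intro Es b
    by_cases hEs : Es ∈ G.pathUnions s t (k + 1)
    · obtain ⟨T, hT, hTE⟩ := hsub Es hEs
      obtain ⟨S, hS, hS'⟩ := Set.exists_min_image
        {T | T ∈ G.kPathsSystem s t k ∧ T ⊆ Es} (scaledBid (w Es) b) (Set.toFinite _)
        ⟨T, hT, hTE⟩
      exact ⟨S, fun _ => ⟨hS, fun T h h' => hS' T ⟨h, h'⟩⟩⟩
    · exact ⟨∅, fun h => absurd h hEs⟩
  choose sel hsel using h2
  exact ⟨⟨pr, hpr, hpr', w, fun Es _ => hw Es, sel, fun Es h b => (hsel Es b h).1,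
    fun Es h b => (hsel Es b h).2⟩⟩

namespace DiMultigraph

variable {V E : Type*} {G : DiMultigraph V E}

/-! ## Walks and paths -/

theorem IsWalk.append {u v w : V} {p q : List E} (hp : G.IsWalk v u p) (hq : G.IsWalk w v q) :
    G.IsWalk w u (p ++ q) := by
  induction p generalizing u with
  | nil => obtain rfl : u = v := hp; exact hq
  | cons e p ih => exact ⟨hp.1, ih hp.2⟩

theorem isWalk_append_cons {u v : V} {p q : List E} {e : E} :
    G.IsWalk v u (p ++ e :: q) ↔ G.IsWalk (G.src e) u p ∧ G.IsWalk v (G.tgt e) q := by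
  induction p generalizing u with
  | nil => simp [IsWalk, eq_comm]
  | cons e' p ih => simp [IsWalk, ih, and_assoc]

theorem IsPath.nodup {s t : V} {p : List E} (hp : G.IsPath s t p) : p.Nodup :=
  (List.nodup_cons.1 hp.2).2.of_map

theorem IsPath.exists_suffix {x u v : V} {q : List E} (hq : G.IsPath x v q)
    (hu : u ∈ x :: q.map G.tgt) : ∃ q', G.IsPath u v q' ∧ q' ⊆ q := by
  rcases List.mem_cons.1 hu with rfl | hu
  · exact ⟨q, hq, List.Subset.refl _⟩
  · obtain ⟨e, he, rfl⟩ := List.mem_map.1 hu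
    obtain ⟨a, b, rfl⟩ := List.append_of_mem he
    refine ⟨b, ⟨(isWalk_append_cons.1 hq.1).2, ?_⟩, fun x hx => by simp [hx]⟩
    have h := (List.nodup_cons.1 hq.2).2
    rw [List.map_append, List.map_cons] at h
    exact (List.nodup_append.1 h).2.1

theorem IsWalk.exists_isPath {u v : V} {p : List E} (hp : G.IsWalk v u p) :
    ∃ q, G.IsPath u v q ∧ q ⊆ p := by
  induction p generalizing u with
  | nil => exact ⟨[], ⟨hp, by simp⟩, List.Subset.refl _⟩
  | cons e p ih =>
    obtain ⟨q, hq, hqp⟩ := ih hp.2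
    by_cases hu : u ∈ G.tgt e :: q.map G.tgt
    · obtain ⟨q', hq', hs⟩ := hq.exists_suffix hu
      exact ⟨q', hq', fun x hx => List.mem_cons_of_mem _ (hqp (hs hx))⟩
    · exact ⟨e :: q, ⟨⟨hp.1, hq.1⟩, List.nodup_cons.2 ⟨hu, hq.2⟩⟩, List.cons_subset_cons _ hqp⟩

/-- Some walk from `u` to `v` uses only edges of `A`. -/
def Reaches (G : DiMultigraph V E) (A : Set E) (u v : V) : Prop :=
  ∃ p, G.IsWalk v u p ∧ ∀ e ∈ p, e ∈ A

theorem Reaches.trans {A : Set E} {u v w : V} (h : G.Reaches A u v) (h' : G.Reaches A v w) :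
    G.Reaches A u w := by
  obtain ⟨p, hp, hpA⟩ := h
  obtain ⟨q, hq, hqA⟩ := h'
  refine ⟨p ++ q, hp.append hq, fun e he => ?_⟩
  exact (List.mem_append.1 he).elim (hpA e) (hqA e)

theorem reaches_edge {A : Set E} {e : E} (he : e ∈ A) : G.Reaches A (G.src e) (G.tgt e) :=
  ⟨[e], ⟨rfl, rfl⟩, by simpa using he⟩

theorem IsWalk.reaches_src {A : Set E} {u v : V} {p : List E} {e : E} (hp : G.IsWalk v u p)
    (hA : ∀ e ∈ p, e ∈ A) (he : e ∈ p) : G.Reaches A u (G.src e) := by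
  obtain ⟨a, b, rfl⟩ := List.append_of_mem he
  exact ⟨a, (isWalk_append_cons.1 hp).1, fun x hx => hA x (by simp [hx])⟩

theorem IsWalk.tgt_reaches {A : Set E} {u v : V} {p : List E} {e : E} (hp : G.IsWalk v u p)
    (hA : ∀ e ∈ p, e ∈ A) (he : e ∈ p) : G.Reaches A (G.tgt e) v := by
  obtain ⟨a, b, rfl⟩ := List.append_of_mem he
  exact ⟨b, (isWalk_append_cons.1 hp).2, fun x hx => hA x (by simp [hx])⟩

/-- Of two edges on a walk one is reached from the other. -/
theorem IsWalk.reaches_or_reaches {A : Set E} {u v : V} {p : List E} {e e' : E}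
    (hp : G.IsWalk v u p) (hA : ∀ e ∈ p, e ∈ A) (he : e ∈ p) (he' : e' ∈ p) (hne : e ≠ e') :
    G.Reaches A (G.tgt e) (G.src e') ∨ G.Reaches A (G.tgt e') (G.src e) := by
  obtain ⟨a, b, rfl⟩ := List.append_of_mem he
  obtain ⟨h1, h2⟩ := isWalk_append_cons.1 hp
  have he'' : e' ∈ a ∨ e' ∈ b := by simpa [hne.symm] using he'
  rcases he'' with h | h
  · exact Or.inr (h1.tgt_reaches (fun x hx => hA x (by simp [hx])) h)
  · exact Or.inl (h2.reaches_src (fun x hx => hA x (by simp [hx])) h)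

/-- A finite set of edges that is linearly ordered by reachability lies on a common walk. -/
theorem exists_isWalk_of_chain [DecidableEq E] {A : Set E} {t : V} (C : Finset E)
    (hCA : ∀ e ∈ C, e ∈ A)
    (hirr : ∀ e ∈ C, ¬ G.Reaches A (G.tgt e) (G.src e))
    (hcmp : ∀ e ∈ C, ∀ e' ∈ C, e ≠ e' →
      G.Reaches A (G.tgt e) (G.src e') ∨ G.Reaches A (G.tgt e') (G.src e))
    (hend : ∀ e ∈ C, G.Reaches A (G.tgt e) t) (u : V)
    (hu : ∀ e ∈ C, G.Reaches A u (G.src e)) (hut : G.Reaches A u t) :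
    ∃ p, G.IsWalk t u p ∧ (∀ e ∈ p, e ∈ A) ∧ ∀ e ∈ C, e ∈ p := by
  induction C using Finset.strongInduction generalizing u with
  | H C ih =>
  rcases C.eq_empty_or_nonempty with rfl | hne
  · obtain ⟨p, hp, hpA⟩ := hut
    exact ⟨p, hp, hpA, by simp⟩
  let r : C → C → Prop := fun e e' => G.Reaches A (G.tgt e.1) (G.src e'.1)
  have htr : IsTrans C r :=
    ⟨fun a b c hab hbc => (hab.trans (reaches_edge (hCA b.1 b.2))).trans hbc⟩
  have hir : Std.Irrefl r := ⟨fun a => hirr a.1 a.2⟩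
  have hwf : WellFounded r := Finite.wellFounded_of_trans_of_irrefl r
  have : Nonempty C := hne.to_subtype
  obtain ⟨m, -, hm⟩ := hwf.has_min Set.univ Set.univ_nonempty
  have hsub : C.erase m.1 ⊂ C := Finset.erase_ssubset m.2
  obtain ⟨p, hp, hpA, hpC⟩ := ih _ hsub
    (fun e he => hCA e (hsub.1 he)) (fun e he => hirr e (hsub.1 he))
    (fun e he e' he' => hcmp e (hsub.1 he) e' (hsub.1 he'))
    (fun e he => hend e (hsub.1 he)) (G.tgt m.1)
    (fun e he => (hcmp m.1 m.2 e (hsub.1 he) (Finset.ne_of_mem_erase he).symm).resolve_right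
      (hm ⟨e, hsub.1 he⟩ (Set.mem_univ _)))
    (hend m.1 m.2)
  obtain ⟨q, hq, hqA⟩ := hu m.1 m.2
  refine ⟨q ++ m.1 :: p, isWalk_append_cons.2 ⟨hq, hp⟩, fun e he => ?_, fun e he => ?_⟩
  · rcases List.mem_append.1 he with h | h
    · exact hqA e h
    · rcases List.mem_cons.1 h with rfl | h
      · exact hCA _ m.2
      · exact hpA e h
  · by_cases h : e = m.1
    · simp [h]
    · simp [hpC e (Finset.mem_erase.2 ⟨h, he⟩)]

theorem IsPath.nodup_cycle {e : E} {p : List E} (hp : G.IsPath (G.tgt e) (G.src e) p) :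
    (e :: p).Nodup := by
  refine List.nodup_cons.2 ⟨fun he => ?_, hp.nodup⟩
  exact (List.nodup_cons.1 hp.2).1 (List.mem_map.2 ⟨e, he, rfl⟩)

theorem mem_kPathsSystem_of_subset {s t : V} {k : ℕ} {A T : Finset E}
    (hA : A ∈ G.pathUnions s t k) (hAT : A ⊆ T) : T ∈ G.kPathsSystem s t k := by
  obtain ⟨P, hP, h⟩ := hA
  exact ⟨P, hP, fun i e he => hAT ((h e).2 ⟨i, he⟩)⟩

section Indicator

variable [DecidableEq E]

theorem IsPath.count_le_one {s t : V} {p : List E} (hp : G.IsPath s t p) (e : E) :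
    (p.count e : ℤ) ≤ 1 := by
  exact_mod_cast List.nodup_iff_count_le_one.1 hp.nodup e

/-- The characteristic function of a set of edges. -/
def chi (A : Finset E) (e : E) : ℤ := if e ∈ A then 1 else 0

theorem chi_nonneg (A : Finset E) (e : E) : 0 ≤ chi A e := by
  unfold chi; split_ifs <;> simp

theorem chi_le_one (A : Finset E) (e : E) : chi A e ≤ 1 := by
  unfold chi; split_ifs <;> simp

/-- The edge set of a system of paths. -/
def edgeUnion {n : ℕ} (P : Fin n → List E) : Finset E :=
  Finset.univ.biUnion fun i => (P i).toFinset

theorem mem_edgeUnion {n : ℕ} {P : Fin n → List E} {e : E} :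
    e ∈ edgeUnion P ↔ ∃ i, e ∈ P i := by
  simp [edgeUnion]

theorem edgeUnion_mem_pathUnions {s t : V} {n : ℕ} {P : Fin n → List E}
    (hP : G.EdgeDisjointPaths s t P) : edgeUnion P ∈ G.pathUnions s t n :=
  ⟨P, hP, fun _ => mem_edgeUnion⟩

theorem IsPath.count_le {s t : V} {p : List E} (hp : G.IsPath s t p) {f : E → ℤ}
    (h0 : ∀ e, 0 ≤ f e) (hpf : ∀ e ∈ p, 0 < f e) (e : E) : (p.count e : ℤ) ≤ f e := by
  by_cases he : e ∈ p
  · exact (hp.count_le_one e).trans (hpf e he)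
  · simpa [List.count_eq_zero_of_not_mem he] using h0 e

theorem EdgeDisjointPaths.sum_count {s t : V} {n : ℕ} {P : Fin n → List E}
    (hP : G.EdgeDisjointPaths s t P) (e : E) :
    ∑ i, ((P i).count e : ℤ) = chi (edgeUnion P) e := by
  by_cases he : ∃ i, e ∈ P i
  · obtain ⟨i, hi⟩ := he
    rw [Finset.sum_eq_single i]
    · rw [chi, if_pos (mem_edgeUnion.2 ⟨i, hi⟩), List.count_eq_one_of_mem (hP.1 i).nodup hi]
      rfl
    · intro j _ hj
      rw [List.count_eq_zero_of_not_mem fun h => hP.2 hj h hi]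
      rfl
    · simp
  · rw [chi, if_neg (fun h => he (mem_edgeUnion.1 h))]
    refine Finset.sum_eq_zero fun i _ => ?_
    rw [List.count_eq_zero_of_not_mem fun h => he ⟨i, h⟩]
    rfl

end Indicator

theorem exists_subset_mem_pathUnions {s t : V} {k : ℕ} {T : Finset E}
    (hT : T ∈ G.kPathsSystem s t k) : ∃ A ∈ G.pathUnions s t k, A ⊆ T := by
  classical
  obtain ⟨P, hP, h⟩ := hT
  refine ⟨_, edgeUnion_mem_pathUnions hP, fun e he => ?_⟩
  obtain ⟨i, hi⟩ := mem_edgeUnion.1 he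
  exact h i e hi

/-! ## Integral flows -/

section Flow

variable [Fintype E]

/-- `f` is a flow of value `n` from `s` to `t`. Conservation is expressed by summation against
potentials. -/
def IsFlow (G : DiMultigraph V E) (s t : V) (f : E → ℤ) (n : ℤ) : Prop :=
  ∀ φ : V → ℤ, ∑ e, f e * (φ (G.tgt e) - φ (G.src e)) = n * (φ t - φ s)

theorem IsFlow.add {s t : V} {f g : E → ℤ} {m n : ℤ} (hf : G.IsFlow s t f m)
    (hg : G.IsFlow s t g n) : G.IsFlow s t (f + g) (m + n) := by
  intro φ
  simp only [Pi.add_apply, add_mul, Finset.sum_add_distrib, hf φ, hg φ]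

theorem IsFlow.sub {s t : V} {f g : E → ℤ} {m n : ℤ} (hf : G.IsFlow s t f m)
    (hg : G.IsFlow s t g n) : G.IsFlow s t (f - g) (m - n) := by
  intro φ
  simp only [Pi.sub_apply, sub_mul, Finset.sum_sub_distrib, hf φ, hg φ]

theorem IsFlow.sum {s t : V} {ι : Type*} (I : Finset ι) {f : ι → E → ℤ} {n : ι → ℤ}
    (hf : ∀ i ∈ I, G.IsFlow s t (f i) (n i)) :
    G.IsFlow s t (fun e => ∑ i ∈ I, f i e) (∑ i ∈ I, n i) := by
  intro φ
  simp only [Finset.sum_mul]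
  rw [Finset.sum_comm]
  exact Finset.sum_congr rfl fun i hi => hf i hi φ

theorem IsFlow.change_ends {s t : V} {f : E → ℤ} (hf : G.IsFlow s t f 0) (s' t' : V) :
    G.IsFlow s' t' f 0 := by
  intro φ
  simpa using hf φ

theorem IsWalk.isFlow [DecidableEq E] {u v : V} {p : List E} (hp : G.IsWalk v u p) :
    G.IsFlow u v (fun e => (p.count e : ℤ)) 1 := by
  intro φ
  induction p generalizing u with
  | nil => obtain rfl : u = v := hp; simp
  | cons e p ih =>
    have h := ih hp.2
    simp only [List.count_cons, Nat.cast_add, add_mul, Finset.sum_add_distrib, h]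
    have : ∑ x, ((if (e == x) = true then 1 else 0 : ℕ) : ℤ) * (φ (G.tgt x) - φ (G.src x)) =
        φ (G.tgt e) - φ (G.src e) := by
      simp
    rw [this, hp.1]
    ring

/-- A nonnegative flow of positive value contains a path. -/
theorem IsFlow.exists_isPath {s t : V} {f : E → ℤ} {n : ℤ} (hf : G.IsFlow s t f n)
    (h0 : ∀ e, 0 ≤ f e) (hn : 0 < n) : ∃ p, G.IsPath s t p ∧ ∀ e ∈ p, 0 < f e := by
  classical
  let A : Set E := {e | 0 < f e}
  by_cases ht : G.Reaches A s t
  · obtain ⟨p, hp, hpA⟩ := ht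
    obtain ⟨q, hq, hqp⟩ := hp.exists_isPath
    exact ⟨q, hq, fun e he => hpA e (hqp he)⟩
  exfalso
  have h := hf fun x => if G.Reaches A s x then 0 else 1
  have hs : G.Reaches A s s := ⟨[], rfl, by simp⟩
  rw [if_neg ht, if_pos hs] at h
  have hle : ∑ e, f e * ((if G.Reaches A s (G.tgt e) then 0 else 1) -
      (if G.Reaches A s (G.src e) then 0 else 1)) ≤ 0 := by
    refine Finset.sum_nonpos fun e _ => ?_
    rcases (h0 e).eq_or_lt with he | he
    · simp [← he]
    · refine mul_nonpos_of_nonneg_of_nonpos he.le ?_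
      have : G.Reaches A s (G.src e) → G.Reaches A s (G.tgt e) :=
        fun h => h.trans (reaches_edge he)
      split_ifs with h1 h2 h2 <;> simp_all
  linarith

variable [DecidableEq E]

/-- In a nonnegative circulation every edge of the support lies on a cycle of the support. -/
theorem IsFlow.exists_cycle {s t : V} {f : E → ℤ} (hf : G.IsFlow s t f 0) (h0 : ∀ e, 0 ≤ f e)
    {e : E} (he : 0 < f e) : ∃ p, G.IsPath (G.tgt e) (G.src e) p ∧ ∀ x ∈ p, 0 < f x := by
  have h1 : G.IsFlow (G.tgt e) (G.src e) (f - fun x => (([e] : List E).count x : ℤ)) 1 := by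
    intro φ
    have h2 := (hf.change_ends (G.src e) (G.tgt e)).sub
      (IsWalk.isFlow (G := G) (u := G.src e) (v := G.tgt e) (p := [e]) ⟨rfl, rfl⟩) φ
    rw [h2]
    ring
  have hle : ∀ x, (([e] : List E).count x : ℤ) ≤ f x := by
    intro x
    by_cases hx : x = e
    · subst hx
      simpa using Int.add_one_le_iff.2 he
    · simpa [List.count_eq_zero_of_not_mem (show x ∉ [e] by simpa using hx)] using h0 x
  obtain ⟨p, hp, hpf⟩ := h1.exists_isPath (fun x => sub_nonneg.2 (hle x)) one_pos
  refine ⟨p, hp, fun x hx => ?_⟩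
  have := hpf x hx
  simp only [Pi.sub_apply] at this
  have : (0 : ℤ) ≤ (([e] : List E).count x : ℤ) := Int.natCast_nonneg _
  linarith

/-- A simple cycle, given by an edge and a path from its target to its source. -/
theorem IsPath.isFlow_cycle {e : E} {p : List E} (hp : G.IsPath (G.tgt e) (G.src e) p) (s t : V) :
    G.IsFlow s t (fun x => ((e :: p).count x : ℤ)) 0 := by
  have h : G.IsWalk (G.src e) (G.src e) (e :: p) := ⟨rfl, hp.1⟩
  intro φ
  rw [h.isFlow φ]
  ring

/-- A flow of value `n` with unit capacities contains `n` edge-disjoint paths. -/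
theorem IsFlow.exists_paths {s t : V} {n : ℕ} {f : E → ℤ} (hf : G.IsFlow s t f n)
    (h0 : ∀ e, 0 ≤ f e) (h1 : ∀ e, f e ≤ 1) :
    ∃ P : Fin n → List E, G.EdgeDisjointPaths s t P ∧ ∀ i, ∀ e ∈ P i, 0 < f e := by
  induction n generalizing f with
  | zero => exact ⟨fun _ => [], ⟨fun i => i.elim0, fun i => i.elim0⟩, fun i => i.elim0⟩
  | succ n ih =>
    obtain ⟨p, hp, hpf⟩ := hf.exists_isPath h0 (by positivity)
    have hle := hp.count_le h0 hpf
    obtain ⟨P, hP, hPf⟩ := ih (f := f - fun e => (p.count e : ℤ))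
      (by simpa using hf.sub hp.1.isFlow) (fun e => sub_nonneg.2 (hle e))
      (fun e => (sub_le_self _ (Int.natCast_nonneg _)).trans (h1 e))
    have hdisj : ∀ i, List.Disjoint p (P i) := by
      intro i e hep hei
      have h := hPf i e hei
      simp only [Pi.sub_apply] at h
      have : 0 < p.count e := List.count_pos_iff.2 hep
      have := h1 e
      omega
    refine ⟨Fin.cons p P, ⟨fun i => ?_, fun i j hij => ?_⟩, fun i => ?_⟩
    · cases i using Fin.cases with
      | zero => simpa using hp
      | succ i => simpa using hP.1 i
    · cases i using Fin.cases with
      | zero =>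
        cases j using Fin.cases with
        | zero => exact absurd rfl hij
        | succ j => simpa using hdisj j
      | succ i =>
        cases j using Fin.cases with
        | zero => simpa using (hdisj i).symm
        | succ j => simpa using hP.2 (fun h => hij (by rw [h]))
    · cases i using Fin.cases with
      | zero => simpa using hpf
      | succ i =>
        intro e he
        have h := hPf i e (by simpa using he)
        simp only [Pi.sub_apply] at h
        have : (0 : ℤ) ≤ (p.count e : ℤ) := Int.natCast_nonneg _
        linarith

theorem isFlow_chi_of_mem_pathUnions {s t : V} {n : ℕ} {A : Finset E}
    (hA : A ∈ G.pathUnions s t n) : G.IsFlow s t (chi A) n := by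
  obtain ⟨P, hP, hE⟩ := hA
  obtain rfl : A = edgeUnion P := by ext e; rw [hE, mem_edgeUnion]
  have h := IsFlow.sum Finset.univ fun i _ => (hP.1 i).1.isFlow
  have h2 : (fun e => ∑ i, ((P i).count e : ℤ)) = chi (edgeUnion P) := funext hP.sum_count
  rw [h2] at h
  simpa using h

/-- A flow of value `n` with unit capacities contains a union of `n` edge-disjoint paths. -/
theorem IsFlow.exists_mem_pathUnions {s t : V} {n : ℕ} {f : E → ℤ} (hf : G.IsFlow s t f n)
    (h0 : ∀ e, 0 ≤ f e) (h1 : ∀ e, f e ≤ 1) : ∃ A ∈ G.pathUnions s t n, ∀ e, chi A e ≤ f e := by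
  obtain ⟨P, hP, hPf⟩ := hf.exists_paths h0 h1
  refine ⟨_, edgeUnion_mem_pathUnions hP, fun e => ?_⟩
  unfold chi
  split_ifs with h
  · obtain ⟨i, hi⟩ := mem_edgeUnion.1 h
    exact hPf i e hi
  · exact h0 e

end Flow

end DiMultigraph

namespace DiMultigraph

variable {V E : Type*} {G : DiMultigraph V E}

/-! ## The structure of a union of `k + 1` edge-disjoint paths -/

/-- The edge `e` lies on a closed walk within `A`. -/
def OnCycle (G : DiMultigraph V E) (A : Set E) (e : E) : Prop :=
  G.Reaches A (G.tgt e) (G.src e)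

/-- Two edges one of which is reached from the other one within `A`. -/
def Comparable (G : DiMultigraph V E) (A : Set E) (e e' : E) : Prop :=
  G.Reaches A (G.tgt e) (G.src e') ∨ G.Reaches A (G.tgt e') (G.src e)

variable [Fintype E] [DecidableEq E]

/-- A unit flow contains a path through all edges of its support that lie on no cycle. -/
theorem IsFlow.exists_isPath_through {s t : V} {f : E → ℤ} (hf : G.IsFlow s t f 1)
    (h0 : ∀ e, 0 ≤ f e) {A : Set E} (hA : ∀ e, 0 < f e → e ∈ A) :
    ∃ p, G.IsPath s t p ∧ (∀ e ∈ p, 0 < f e) ∧ ∀ e, 0 < f e → ¬ G.OnCycle A e → e ∈ p := by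
  obtain ⟨p, hp, hpf⟩ := hf.exists_isPath h0 one_pos
  refine ⟨p, hp, hpf, fun e he hcyc => ?_⟩
  by_contra hep
  apply hcyc
  have hc : G.IsFlow s t (f - fun e => (p.count e : ℤ)) 0 := by simpa using hf.sub hp.1.isFlow
  obtain ⟨q, hq, hqf⟩ := hc.exists_cycle (fun e => sub_nonneg.2 (hp.count_le h0 hpf e)) (e := e)
    (by simpa [List.count_eq_zero_of_not_mem hep] using he)
  refine ⟨q, hq.1, fun x hx => hA x ?_⟩
  have h1 := hqf x hx
  simp only [Pi.sub_apply] at h1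
  have : (0 : ℤ) ≤ (p.count x : ℤ) := Int.natCast_nonneg _
  linarith

/-- If two edges on no cycle can be left out simultaneously, then they are comparable. -/
theorem comparable_of_notMem {s t : V} {k : ℕ} {Es T : Finset E}
    (hEs : Es ∈ G.pathUnions s t (k + 1)) (hT : T ∈ G.kPathsSystem s t k) (hTE : T ⊆ Es)
    {e e' : E} (he : e ∈ Es \ T) (he' : e' ∈ Es \ T) (hne : e ≠ e')
    (hc : ¬ G.OnCycle Es e) (hc' : ¬ G.OnCycle Es e') : G.Comparable Es e e' := by
  obtain ⟨A, hA, hAT⟩ := exists_subset_mem_pathUnions hT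
  have hf : G.IsFlow s t (chi Es - chi A) 1 := by
    simpa using (isFlow_chi_of_mem_pathUnions hEs).sub (isFlow_chi_of_mem_pathUnions hA)
  have h0 : ∀ e, 0 ≤ (chi Es - chi A) e := by
    intro e
    have : e ∈ A → e ∈ Es := fun h => hTE (hAT h)
    simp only [Pi.sub_apply, chi]
    split_ifs <;> simp_all
  have hpos : ∀ e ∈ Es \ T, 0 < (chi Es - chi A) e := by
    intro e he
    obtain ⟨h1, h2⟩ := Finset.mem_sdiff.1 he
    simp [chi, h1, show e ∉ A from fun h => h2 (hAT h)]
  have hsupp : ∀ e, 0 < (chi Es - chi A) e → e ∈ (Es : Set E) := by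
    intro e he
    by_contra h
    have := chi_nonneg A e
    simp only [Pi.sub_apply, chi, if_neg (fun h' => h (Finset.mem_coe.2 h'))] at he this
    linarith
  obtain ⟨p, hp, hpf, hthrough⟩ := hf.exists_isPath_through h0 hsupp
  exact hp.1.reaches_or_reaches (fun x hx => hsupp x (hpf x hx)) (hthrough e (hpos e he) hc)
    (hthrough e' (hpos e' he') hc') hne

/-- A set of pairwise comparable edges on no cycle can be left out. -/
theorem sdiff_mem_kPathsSystem {s t : V} {k : ℕ} {Es C : Finset E}
    (hEs : Es ∈ G.pathUnions s t (k + 1)) (hC : C ⊆ Es) (hc : ∀ e ∈ C, ¬ G.OnCycle Es e)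
    (hcmp : ∀ e ∈ C, ∀ e' ∈ C, e ≠ e' → G.Comparable Es e e') :
    Es \ C ∈ G.kPathsSystem s t k := by
  obtain ⟨P, hP, hPE⟩ := id hEs
  have hPA : ∀ i, ∀ e ∈ P i, e ∈ (Es : Set E) := fun i e he => (hPE e).2 ⟨i, he⟩
  obtain ⟨p, hp, hpA, hpC⟩ := exists_isWalk_of_chain (A := (Es : Set E)) (t := t) C
    (fun e he => hC he) hc hcmp
    (fun e he => by
      obtain ⟨i, hi⟩ := (hPE e).1 (hC he)
      exact (hP.1 i).1.tgt_reaches (hPA i) hi) s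
    (fun e he => by
      obtain ⟨i, hi⟩ := (hPE e).1 (hC he)
      exact (hP.1 i).1.reaches_src (hPA i) hi)
    ⟨P 0, (hP.1 0).1, hPA 0⟩
  obtain ⟨q, hq, hqp, hthrough⟩ := hp.isFlow.exists_isPath_through
    (fun e => Int.natCast_nonneg _) (A := (Es : Set E))
    (fun e he => hpA e (List.count_pos_iff.1 (by exact_mod_cast he)))
  have hqE : ∀ e ∈ q, 0 < chi Es e := fun e he => by
    have h := hpA e (List.count_pos_iff.1 (by exact_mod_cast hqp e he))
    simp [chi, Finset.mem_coe.1 h]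
  have hf : G.IsFlow s t (chi Es - fun e => (q.count e : ℤ)) k := by
    simpa using (isFlow_chi_of_mem_pathUnions hEs).sub hq.1.isFlow
  obtain ⟨A, hA, hAf⟩ := hf.exists_mem_pathUnions
    (fun e => sub_nonneg.2 (hq.count_le (chi_nonneg Es) hqE e))
    (fun e => (sub_le_self _ (Int.natCast_nonneg _)).trans (chi_le_one Es e))
  refine mem_kPathsSystem_of_subset hA fun e he => ?_
  have h := hAf e
  simp only [Pi.sub_apply] at h
  rw [chi, if_pos he] at h
  have h1 := chi_le_one Es e
  have h2 : (0 : ℤ) ≤ (q.count e : ℤ) := Int.natCast_nonneg _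
  refine Finset.mem_sdiff.2 ⟨?_, fun heC => ?_⟩
  · by_contra hn
    rw [chi, if_neg hn] at h
    linarith
  · have : e ∈ q := hthrough e (by exact_mod_cast List.count_pos_iff.2 (hpC e heC)) (hc e heC)
    have : 0 < q.count e := List.count_pos_iff.2 this
    omega

/-- An edge on a cycle is dispensable. -/
theorem exists_mem_pathUnions_of_onCycle {s t : V} {n : ℕ} {Es : Finset E}
    (hEs : Es ∈ G.pathUnions s t n) {e : E} (he : e ∈ Es) (hc : G.OnCycle Es e) :
    ∃ A ∈ G.pathUnions s t n, A ⊆ Es.erase e := by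
  obtain ⟨p, hp, hpE⟩ := hc
  obtain ⟨q, hq, hqp⟩ := hp.exists_isPath
  have hf : G.IsFlow s t (chi Es - fun x => ((e :: q).count x : ℤ)) n := by
    simpa using (isFlow_chi_of_mem_pathUnions hEs).sub (hq.isFlow_cycle s t)
  have hle : ∀ x, ((e :: q).count x : ℤ) ≤ chi Es x := by
    intro x
    by_cases hx : x ∈ e :: q
    · have hxE : x ∈ Es := by
        rcases List.mem_cons.1 hx with rfl | h
        · exact he
        · exact hpE x (hqp h)
      rw [chi, if_pos hxE]
      exact_mod_cast List.nodup_iff_count_le_one.1 hq.nodup_cycle x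
    · rw [List.count_eq_zero_of_not_mem hx]
      exact chi_nonneg Es x
  obtain ⟨A, hA, hAf⟩ := hf.exists_mem_pathUnions (fun x => sub_nonneg.2 (hle x))
    (fun x => (sub_le_self _ (Int.natCast_nonneg _)).trans (chi_le_one Es x))
  refine ⟨A, hA, fun x hx => ?_⟩
  have h := hAf x
  simp only [Pi.sub_apply] at h
  rw [chi, if_pos hx] at h
  have h1 := chi_le_one Es x
  have h2 : (0 : ℤ) ≤ ((e :: q).count x : ℤ) := Int.natCast_nonneg _
  refine Finset.mem_erase.2 ⟨?_, ?_⟩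
  · rintro rfl
    have : 0 < (x :: q).count x := List.count_pos_iff.2 List.mem_cons_self
    omega
  · by_contra hn
    rw [chi, if_neg hn] at h
    linarith

end DiMultigraph

/-! ## Weights and eigenvalues -/

/-- Adjacency in the dependency graph, as a relation between agents. -/
def Depends {E : Type*} (F : Set (Finset E)) (Es : Finset E) (e e' : E) : Prop :=
  e ≠ e' ∧ ∀ T ∈ F, T ⊆ Es → e ∈ T ∨ e' ∈ T

theorem Depends.symm {E : Type*} {F : Set (Finset E)} {Es : Finset E} {e e' : E}
    (h : Depends F Es e e') : Depends F Es e' e :=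
  ⟨h.1.symm, fun T hT hTE => (h.2 T hT hTE).symm⟩

theorem dependencyGraph_adj {E : Type*} {F : Set (Finset E)} {Es : Finset E}
    {e e' : {e : E // e ∈ Es}} : (dependencyGraph F Es).Adj e e' ↔ Depends F Es e e' :=
  ⟨fun h => ⟨fun h' => h.1 (Subtype.ext h'), h.2⟩, fun h => ⟨fun h' => h.1 (congrArg _ h'), h.2⟩⟩

theorem IsLiftingWeight.pos {E : Type*} {F : Set (Finset E)} {Es : Finset E} {w : E → ℝ}
    (hw : IsLiftingWeight F Es w) {e : E} (he : e ∈ Es) : 0 < w e :=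
  (hw ((dependencyGraph F Es).connectedComponentMk ⟨e, he⟩)).1 ⟨⟨e, he⟩, rfl⟩

open Classical in
theorem IsLiftingWeight.sum_depends {E : Type*} {F : Set (Finset E)} {Es : Finset E} {w : E → ℝ}
    (hw : IsLiftingWeight F Es w) {e : E} (he : e ∈ Es) :
    ∑ u ∈ Es with Depends F Es e u, w u =
      componentEigenvalue ((dependencyGraph F Es).connectedComponentMk ⟨e, he⟩) * w e := by
  set H := dependencyGraph F Es
  set C := H.connectedComponentMk ⟨e, he⟩ with hC
  have h := congrFun (hw C).2 ⟨⟨e, he⟩, rfl⟩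
  simp only [Matrix.mulVec, dotProduct, Pi.smul_apply, smul_eq_mul] at h
  rw [← h, Finset.sum_filter, ← Finset.sum_coe_sort]
  have hout : ∀ u : {e : E // e ∈ Es}, u ∉ Finset.univ.filter (· ∈ C.supp) →
      (if Depends F Es e u then w u else 0) = 0 := by
    intro u hu
    refine if_neg fun hd => hu ?_
    have hadj : H.Adj ⟨e, he⟩ u := dependencyGraph_adj.2 hd
    simpa [hC] using hadj.symm.reachable
  rw [← Finset.sum_subset (Finset.subset_univ _) fun u _ => hout u,
    Finset.sum_subtype _ (p := (· ∈ C.supp)) (by simp)]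
  refine Finset.sum_congr rfl fun v _ => ?_
  simp only [componentMatrix, SimpleGraph.adjMatrix_apply, SimpleGraph.comap_adj, ite_mul, one_mul,
    zero_mul, Function.Embedding.subtype_apply]
  exact if_congr (dependencyGraph_adj (e := ⟨e, he⟩) (e' := v.1)).symm rfl rfl

theorem componentEigenvalue_le_graphEigenvalue {W : Type*} [Fintype W] {H : SimpleGraph W}
    (C : H.ConnectedComponent) : componentEigenvalue C ≤ graphEigenvalue H :=
  le_ciSup (f := fun C : H.ConnectedComponent => componentEigenvalue C)
    (Set.finite_range _).bddAbove C

theorem DiMultigraph.graphEigenvalue_le_alphaSucc {V E : Type*} [Finite E] {G : DiMultigraph V E}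
    {s t : V} {k : ℕ} {Es : Finset E} (hEs : Es ∈ G.pathUnions s t (k + 1)) :
    graphEigenvalue (dependencyGraph (G.kPathsSystem s t k) Es) ≤ G.alphaSucc s t k :=
  le_ciSup (f := fun Es : G.pathUnions s t (k + 1) =>
    graphEigenvalue (dependencyGraph (G.kPathsSystem s t k) Es.1))
    (Set.finite_range _).bddAbove ⟨Es, hEs⟩

namespace PruningLiftingKPaths

open DiMultigraph

variable {V E : Type*} [Fintype E] [DecidableEq E] {G : DiMultigraph V E} {s t : V} {k : ℕ}

/-! ## The payments -/

theorem eq_zero_of_onCycle (M : PruningLiftingKPaths G s t k) {c : E → ℝ≥0} {e : E}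
    (he : e ∈ M.prune c) (hc : G.OnCycle (M.prune c : Set E) e) : c e = 0 := by
  obtain ⟨A, hA, hAE⟩ := exists_mem_pathUnions_of_onCycle (M.prune_mem c) he hc
  have h1 := (M.prune_min c A hA).trans (Finset.sum_le_sum_of_subset hAE)
  rw [← Finset.add_sum_erase _ _ he] at h1
  exact nonpos_iff_eq_zero.1 (by simpa using h1)

theorem pruneThreshold_eq_zero (M : PruningLiftingKPaths G s t k) {c : E → ℝ≥0} {e : E}
    (he : e ∈ M.prune c) (hc : G.OnCycle (M.prune c : Set E) e) : M.pruneThreshold c e = 0 := by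
  have hdrop : ∀ x : ℝ≥0, 0 < x → e ∉ M.prune (Function.update c e x) := by
    intro x hx hex
    obtain ⟨A, hA, hAE⟩ := exists_mem_pathUnions_of_onCycle (M.prune_mem c) he hc
    have heA : e ∉ A := fun h => Finset.notMem_erase _ _ (hAE h)
    have hce := M.eq_zero_of_onCycle he hc
    have h1 := M.prune_min (Function.update c e x) A hA
    rw [Finset.sum_update_of_notMem heA, Finset.sum_update_of_mem hex, Finset.sdiff_singleton_eq_erase]
      at h1
    have h2 := M.prune_min c _ (M.prune_mem (Function.update c e x))
    rw [← Finset.add_sum_erase _ _ hex, hce, zero_add] at h2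
    have h3 : ∑ e ∈ A, c e ≤ ∑ e ∈ M.prune c, c e :=
      Finset.sum_le_sum_of_subset (hAE.trans (Finset.erase_subset _ _))
    have h4 := (add_le_add_right h2 x).trans (h1.trans h3)
    exact absurd h4 (not_le.2 (lt_add_of_pos_left _ hx))
  refine nonpos_iff_eq_zero.1 (ENNReal.le_of_forall_pos_le_add fun ε hε _ => ?_)
  rw [zero_add]
  exact iInf₂_le ε (hdrop ε hε)

open Classical in
theorem selectThreshold_le (M : PruningLiftingKPaths G s t k) {c : E → ℝ≥0} {e : E}
    (he : e ∈ M.prune c) (hc : ¬ G.OnCycle (M.prune c : Set E) e) :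
    M.selectThreshold c e ≤ ENNReal.ofReal (M.weight (M.prune c) e *
      ∑ u ∈ M.prune c with Depends (G.kPathsSystem s t k) (M.prune c) e u,
        (c u : ℝ) / M.weight (M.prune c) u) := by
  refine iSup₂_le fun x hx => ?_
  have hEs := M.prune_mem c
  have hzero := fun u hu h => M.eq_zero_of_onCycle (c := c) (e := u) hu h
  set Es := M.prune c
  set w := M.weight Es
  have hw : ∀ u ∈ Es, 0 < w u := fun u hu => (M.weight_spec Es hEs).pos hu
  have hterm : ∀ u ∈ Es, 0 ≤ (c u : ℝ) / w u := fun u hu =>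
    div_nonneg (c u).coe_nonneg (hw u hu).le
  set b := Function.update c e x with hb
  obtain ⟨hSF, hSE⟩ := M.select_mem Es hEs b
  have hmin : ∀ T ∈ G.kPathsSystem s t k, T ⊆ Es →
      scaledBid w b (M.select Es b) ≤ scaledBid w b T := M.select_min Es hEs b
  set S := M.select Es b
  set N := Es.filter (Depends (G.kPathsSystem s t k) Es e)
  set D := (Es \ S).filter fun u => ¬ G.OnCycle Es u ∧ u ∉ N with hD
  have hDE : insert e D ⊆ Es := Finset.insert_subset he
    ((Finset.filter_subset _ _).trans Finset.sdiff_subset)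
  have hcmpe : ∀ u ∈ D, G.Comparable Es e u := by
    intro u hu
    obtain ⟨hu1, hu2, hu3⟩ := Finset.mem_filter.1 hu
    obtain ⟨huE, huS⟩ := Finset.mem_sdiff.1 hu1
    have hne : e ≠ u := fun h => huS (h ▸ hx)
    have : ¬ Depends (G.kPathsSystem s t k) Es e u := fun h => hu3 (Finset.mem_filter.2 ⟨huE, h⟩)
    simp only [Depends, not_and, not_forall, not_or] at this
    obtain ⟨T, hT, hTE, heT, huT⟩ := this hne
    exact comparable_of_notMem hEs hT hTE (Finset.mem_sdiff.2 ⟨he, heT⟩)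
      (Finset.mem_sdiff.2 ⟨huE, huT⟩) hne hc hu2
  have hT : Es \ insert e D ∈ G.kPathsSystem s t k := by
    refine sdiff_mem_kPathsSystem hEs hDE (fun u hu => ?_) fun u hu u' hu' hne => ?_
    · rcases Finset.mem_insert.1 hu with rfl | hu
      · exact hc
      · exact (Finset.mem_filter.1 hu).2.1
    · rcases Finset.mem_insert.1 hu with rfl | hu
      · exact hcmpe u' ((Finset.mem_insert.1 hu').resolve_left hne.symm)
      · rcases Finset.mem_insert.1 hu' with rfl | hu'
        · exact (hcmpe u hu).symm
        · exact comparable_of_notMem hEs hSF hSE (Finset.mem_filter.1 hu).1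
            (Finset.mem_filter.1 hu').1 hne (Finset.mem_filter.1 hu).2.1
            (Finset.mem_filter.1 hu').2.1
  have h1 := hmin _ hT Finset.sdiff_subset
  have hbc : ∀ A : Finset E, e ∉ A → scaledBid w b A = scaledBid w c A := by
    intro A hA
    refine Finset.sum_congr rfl fun u hu => ?_
    have hne : u ≠ e := fun h => hA (h ▸ hu)
    rw [hb, Function.update_of_ne hne]
  have h2 : scaledBid w b S = x / w e + scaledBid w c (S.erase e) := by
    rw [← hbc _ (Finset.notMem_erase _ _), scaledBid, ← Finset.add_sum_erase _ _ hx, scaledBid, hb,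
      Function.update_self]
  have h3 : scaledBid w c (Es \ insert e D) ≤ scaledBid w c (S.erase e) + scaledBid w c N := by
    have h4 : scaledBid w c (Es \ insert e D) ≤ scaledBid w c (S.erase e ∪ N) := by
      rw [scaledBid, ← Finset.sum_filter_of_ne (p := fun u => ¬ G.OnCycle Es u)]
      · refine Finset.sum_le_sum_of_subset_of_nonneg (fun u hu => ?_) fun u hu _ => ?_
        · simp only [hD, Finset.mem_filter, Finset.mem_sdiff, Finset.mem_insert, not_or] at hu
          simp only [Finset.mem_union, Finset.mem_erase]
          tauto
        · rcases Finset.mem_union.1 hu with h | h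
          · exact hterm u (hSE (Finset.mem_of_mem_erase h))
          · exact hterm u (Finset.filter_subset _ _ h)
      · intro u hu hne hcyc
        exact hne (by rw [hzero u (Finset.mem_sdiff.1 hu).1 hcyc]; simp)
    refine h4.trans ?_
    simp only [scaledBid]
    rw [← Finset.sum_union_inter]
    refine le_add_of_nonneg_right (Finset.sum_nonneg fun u hu => ?_)
    exact hterm u (Finset.filter_subset _ _ (Finset.mem_inter.1 hu).2)
  rw [h2, hbc (Es \ insert e D) (by simp)] at h1
  have h5 : (x : ℝ) / w e ≤ scaledBid w c N := by linarith
  rw [div_le_iff₀' (hw e he)] at h5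
  rw [← ENNReal.ofReal_coe_nnreal]
  exact ENNReal.ofReal_le_ofReal h5

/-- The total payment is at most `α_{k+1}` times the cost of the surviving edges. -/
theorem totalPayment_le (M : PruningLiftingKPaths G s t k) (c : E → ℝ≥0) :
    M.toMechanism.totalPayment c ≤
      ENNReal.ofReal (G.alphaSucc s t k * ∑ e ∈ M.prune c, (c e : ℝ)) := by
  classical
  have hEs := M.prune_mem c
  set F := G.kPathsSystem s t k
  set Es := M.prune c with hEs'
  set w := M.weight Es with hw'
  have hlift := M.weight_spec Es hEs
  have hw : ∀ u ∈ Es, 0 < w u := fun u hu => hlift.pos hu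
  have hterm : ∀ u ∈ Es, 0 ≤ (c u : ℝ) / w u := fun u hu =>
    div_nonneg (c u).coe_nonneg (hw u hu).le
  have hSE : M.select Es c ⊆ Es := (M.select_mem Es hEs c).2
  have hnn : ∀ e ∈ Es, 0 ≤ w e * ∑ u ∈ Es with Depends F Es e u, (c u : ℝ) / w u := fun e he =>
    mul_nonneg (hw e he).le (Finset.sum_nonneg fun u hu => hterm u (Finset.filter_subset _ _ hu))
  have hpay : ∀ e, M.toMechanism.payment c e ≤ if e ∈ Es then
      ENNReal.ofReal (w e * ∑ u ∈ Es with Depends F Es e u, (c u : ℝ) / w u) else 0 := by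
    intro e
    simp only [toMechanism]
    split_ifs with h1 h2 h2
    · by_cases hc : G.OnCycle Es e
      · exact (min_le_left _ _).trans ((M.pruneThreshold_eq_zero h2 hc).le.trans zero_le)
      · exact (min_le_right _ _).trans (M.selectThreshold_le h2 hc)
    · exact absurd (hSE h1) h2
    · exact zero_le
    · exact le_rfl
  calc M.toMechanism.totalPayment c
      ≤ ∑ e ∈ Es, ENNReal.ofReal (w e * ∑ u ∈ Es with Depends F Es e u, (c u : ℝ) / w u) := by
        refine (Finset.sum_le_sum fun e _ => hpay e).trans ?_
        rw [Finset.sum_ite_mem, Finset.univ_inter]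
    _ = ENNReal.ofReal (∑ e ∈ Es, w e * ∑ u ∈ Es with Depends F Es e u, (c u : ℝ) / w u) :=
        (ENNReal.ofReal_sum_of_nonneg hnn).symm
    _ ≤ _ := by
        refine ENNReal.ofReal_le_ofReal ?_
        have hswap : ∑ e ∈ Es, w e * ∑ u ∈ Es with Depends F Es e u, (c u : ℝ) / w u =
            ∑ u ∈ Es, (c u : ℝ) / w u * ∑ e ∈ Es with Depends F Es u e, w e := by
          simp only [Finset.sum_filter, Finset.mul_sum]
          rw [Finset.sum_comm]
          refine Finset.sum_congr rfl fun u _ => Finset.sum_congr rfl fun e _ => ?_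
          by_cases h : Depends F Es e u
          · rw [if_pos h, if_pos h.symm, mul_comm]
          · rw [if_neg h, if_neg fun h' => h h'.symm]; simp
        rw [hswap, Finset.mul_sum]
        refine Finset.sum_le_sum fun u hu => ?_
        rw [hlift.sum_depends hu]
        have hα := (componentEigenvalue_le_graphEigenvalue
          ((dependencyGraph F Es).connectedComponentMk ⟨u, hu⟩)).trans
          (graphEigenvalue_le_alphaSucc hEs)
        have hwu := hw u hu
        change (c u : ℝ) / w u * (_ * w u) ≤ _
        rw [mul_comm _ (w u), ← mul_assoc, div_mul_cancel₀ _ hwu.ne', mul_comm]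
        exact mul_le_mul_of_nonneg_right hα (c u).coe_nonneg

end PruningLiftingKPaths

namespace DiMultigraph

variable {V E : Type*} {G : DiMultigraph V E}

/-! ## Residual graphs and cheapest flows -/

variable [DecidableEq E]

/-- The residual graph with respect to a saturated edge set `U`: the edges of `U` are reversed. -/
def residual (G : DiMultigraph V E) (U : Finset E) : DiMultigraph V E where
  src e := if e ∈ U then G.tgt e else G.src e
  tgt e := if e ∈ U then G.src e else G.tgt e

/-- The orientation of an edge in the residual graph. -/
def residualSign (U : Finset E) (e : E) : ℤ := if e ∈ U then -1 else 1

theorem residualSign_mul_self (U : Finset E) (e : E) : residualSign U e * residualSign U e = 1 := by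
  unfold residualSign; split_ifs <;> norm_num

variable [Fintype E]

theorem isFlow_residual_iff {U : Finset E} {s t : V} {f : E → ℤ} {n : ℤ} :
    (G.residual U).IsFlow s t f n ↔ G.IsFlow s t (fun e => residualSign U e * f e) n := by
  refine forall_congr' fun φ => ?_
  have : ∀ e, f e * (φ ((G.residual U).tgt e) - φ ((G.residual U).src e)) =
      residualSign U e * f e * (φ (G.tgt e) - φ (G.src e)) := by
    intro e
    simp only [residual, residualSign]
    split_ifs <;> ring
  simp only [this]

theorem sum_chi_mul (x : E → ℝ) (A : Finset E) : ∑ e, x e * (chi A e : ℝ) = ∑ e ∈ A, x e := by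
  simp [chi]

/-- Augmentation along a residual flow with unit capacities. -/
theorem exists_augmentation {U : Finset E} {s t : V} {n m : ℕ} (hU : U ∈ G.pathUnions s t n)
    {x : E → ℝ} (hx : ∀ e, 0 ≤ x e) {z : E → ℤ} (hz : (G.residual U).IsFlow s t z m)
    (h0 : ∀ e, 0 ≤ z e) (h1 : ∀ e, z e ≤ 1) :
    ∃ A ∈ G.pathUnions s t (n + m),
      ∑ e ∈ A, x e ≤ ∑ e ∈ U, x e + ∑ e, x e * (residualSign U e * z e : ℤ) := by
  have hf : G.IsFlow s t (chi U + fun e => residualSign U e * z e) (n + m : ℕ) := by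
    simpa using (isFlow_chi_of_mem_pathUnions hU).add (isFlow_residual_iff.1 hz)
  obtain ⟨A, hA, hAf⟩ := hf.exists_mem_pathUnions
    (fun e => by
      have h0 := h0 e
      have h1 := h1 e
      simp only [Pi.add_apply, chi, residualSign]
      split_ifs <;> linarith)
    (fun e => by
      have h0 := h0 e
      have h1 := h1 e
      simp only [Pi.add_apply, chi, residualSign]
      split_ifs <;> linarith)
  refine ⟨A, hA, ?_⟩
  rw [← sum_chi_mul x A, ← sum_chi_mul x U, ← Finset.sum_add_distrib]
  refine Finset.sum_le_sum fun e _ => ?_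
  rw [← mul_add]
  refine mul_le_mul_of_nonneg_left ?_ (hx e)
  exact_mod_cast hAf e

/-- With respect to a cheapest union of paths, residual circulations have nonnegative cost. -/
theorem residual_circulation_cost_nonneg {U : Finset E} {s t : V} {n : ℕ}
    (hU : U ∈ G.pathUnions s t n) {x : E → ℝ} (hx : ∀ e, 0 ≤ x e)
    (hmin : ∀ A ∈ G.pathUnions s t n, ∑ e ∈ U, x e ≤ ∑ e ∈ A, x e) {h : E → ℤ}
    (hh : (G.residual U).IsFlow s t h 0) (h0 : ∀ e, 0 ≤ h e) :
    0 ≤ ∑ e, x e * (residualSign U e * h e : ℤ) := by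
  induction hN : (∑ e, h e).toNat using Nat.strong_induction_on generalizing h with
  | _ N ih =>
  by_cases hzero : ∀ e, h e = 0
  · simp [hzero]
  obtain ⟨e, he⟩ := not_forall.1 hzero
  have he : 0 < h e := lt_of_le_of_ne (h0 e) (Ne.symm he)
  obtain ⟨p, hp, hpf⟩ := hh.exists_cycle h0 he
  have hz := hp.isFlow_cycle s t
  have hz1 : ∀ y, ((e :: p).count y : ℤ) ≤ 1 := fun y => by
    exact_mod_cast List.nodup_iff_count_le_one.1 hp.nodup_cycle y
  have hle : ∀ y, ((e :: p).count y : ℤ) ≤ h y := by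
    intro y
    by_cases hy : y ∈ e :: p
    · refine (hz1 y).trans ?_
      rcases List.mem_cons.1 hy with rfl | hy
      · exact he
      · exact hpf y hy
    · rw [List.count_eq_zero_of_not_mem hy]
      exact h0 y
  have hrest : 0 ≤ ∑ y, x y * (residualSign U y * (h y - ((e :: p).count y : ℤ)) : ℤ) := by
    refine ih _ ?_ (h := h - fun y => ((e :: p).count y : ℤ)) (by simpa using hh.sub hz)
      (fun y => sub_nonneg.2 (hle y)) rfl
    have h1 : ∑ y, (h - fun y => ((e :: p).count y : ℤ)) y < ∑ y, h y := by
      refine Finset.sum_lt_sum (fun y _ => sub_le_self _ (Int.natCast_nonneg _))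
        ⟨e, Finset.mem_univ _, sub_lt_self _ ?_⟩
      have : 0 < (e :: p).count e := List.count_pos_iff.2 List.mem_cons_self
      exact Int.natCast_pos.2 this
    have h2 : 0 ≤ ∑ y, (h - fun y => ((e :: p).count y : ℤ)) y :=
      Finset.sum_nonneg fun y _ => sub_nonneg.2 (hle y)
    omega
  have hcyc : 0 ≤ ∑ y, x y * (residualSign U y * ((e :: p).count y : ℤ) : ℤ) := by
    obtain ⟨A, hA, hAc⟩ := exists_augmentation (m := 0) hU hx (by simpa using hz)
      (fun y => Int.natCast_nonneg _) hz1
    have := hmin A hA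
    linarith
  have hsplit : ∑ y, x y * (residualSign U y * h y : ℤ) =
      ∑ y, x y * (residualSign U y * (h y - ((e :: p).count y : ℤ)) : ℤ) +
        ∑ y, x y * (residualSign U y * ((e :: p).count y : ℤ) : ℤ) := by
    rw [← Finset.sum_add_distrib]
    refine Finset.sum_congr rfl fun y _ => ?_
    push_cast
    ring
  rw [hsplit]
  exact add_nonneg hrest hcyc

/-- If every edge of a cheapest union of `k` paths is avoided by another cheapest one, then one
more path can be added at the average cost. -/
theorem exists_mem_pathUnions_succ {U : Finset E} {s t : V} {k : ℕ} (hk : 1 ≤ k)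
    (hU : U ∈ G.pathUnions s t k) {x : E → ℝ} (hx : ∀ e, 0 ≤ x e)
    (hmin : ∀ A ∈ G.pathUnions s t k, ∑ e ∈ U, x e ≤ ∑ e ∈ A, x e)
    (havoid : ∀ e ∈ U, ∃ A ∈ G.pathUnions s t k, e ∉ A ∧ ∑ e ∈ A, x e = ∑ e ∈ U, x e) :
    ∃ A ∈ G.pathUnions s t (k + 1), k * ∑ e ∈ A, x e ≤ (k + 1) * ∑ e ∈ U, x e := by
  obtain ⟨P, hP, hPU⟩ := id hU
  obtain rfl : U = edgeUnion P := by ext e; rw [hPU, mem_edgeUnion]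
  set U := edgeUnion P with hUdef
  have : Nonempty (Fin k) := ⟨⟨0, hk⟩⟩
  obtain ⟨i, hi⟩ := Finite.exists_min fun i => ∑ e, x e * ((P i).count e : ℝ)
  have havg : k * ∑ e, x e * ((P i).count e : ℝ) ≤ ∑ e ∈ U, x e := by
    calc k * ∑ e, x e * ((P i).count e : ℝ) = ∑ _j : Fin k, ∑ e, x e * ((P i).count e : ℝ) := by
          simp
      _ ≤ ∑ j, ∑ e, x e * ((P j).count e : ℝ) := Finset.sum_le_sum fun j _ => hi j
      _ = ∑ e ∈ U, x e := by
          rw [Finset.sum_comm, ← sum_chi_mul x U]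
          refine Finset.sum_congr rfl fun e _ => ?_
          rw [← Finset.mul_sum, ← hP.sum_count e]
          push_cast
          rfl
  have hiU : ∀ e ∈ P i, e ∈ U := fun e he => mem_edgeUnion.2 ⟨i, he⟩
  choose! B hB hBe hBx using havoid
  let I := (P i).toFinset
  have hIU : ∀ a ∈ I, a ∈ U := fun a ha => hiU a (List.mem_toFinset.1 ha)
  let g : E → ℤ := (fun e => ((P i).count e : ℤ)) + fun e => ∑ a ∈ I, (chi (B a) - chi U) e
  have hg : G.IsFlow s t g 1 := by
    have h := IsFlow.sum (G := G) (s := s) (t := t) I (f := fun a => chi (B a) - chi U)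
      (n := fun _ => 0) fun a ha => by
        simpa using (isFlow_chi_of_mem_pathUnions (hB a (hIU a ha))).sub
          (isFlow_chi_of_mem_pathUnions hU)
    rw [Finset.sum_const_zero] at h
    rw [← add_zero (1 : ℤ)]
    exact (hP.1 i).1.isFlow.add h
  have hgx : ∑ e, x e * (g e : ℝ) = ∑ e, x e * ((P i).count e : ℝ) := by
    simp only [g, Pi.add_apply, Pi.sub_apply]
    push_cast
    simp only [mul_add, Finset.sum_add_distrib, add_eq_left, Finset.mul_sum]
    rw [Finset.sum_comm]
    refine Finset.sum_eq_zero fun a ha => ?_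
    simp only [mul_sub, Finset.sum_sub_distrib, sum_chi_mul]
    rw [hBx a (hIU a ha), sub_self]
  have hgU : ∀ e ∈ U, g e ≤ 0 := by
    intro e he
    have hnp : ∀ a ∈ I, (chi (B a) - chi U) e ≤ 0 := fun a _ => by
      have := chi_le_one (B a) e
      simp only [Pi.sub_apply, chi, if_pos he] at this ⊢
      linarith
    by_cases hei : e ∈ P i
    · have heI : e ∈ I := List.mem_toFinset.2 hei
      have h1 : (chi (B e) - chi U) e = -1 := by
        simp [chi, he, hBe e he]
      have h2 : ∑ a ∈ I, (chi (B a) - chi U) e ≤ (chi (B e) - chi U) e := by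
        rw [← Finset.add_sum_erase _ _ heI]
        have := Finset.sum_nonpos fun a ha => hnp a (Finset.mem_of_mem_erase (a := e) ha)
        linarith
      have := (hP.1 i).count_le_one e
      simp only [g, Pi.add_apply]
      linarith
    · simp only [g, Pi.add_apply, List.count_eq_zero_of_not_mem hei]
      simpa using Finset.sum_nonpos hnp
  have hgU' : ∀ e ∉ U, 0 ≤ g e := by
    intro e he
    simp only [g, Pi.add_apply, Pi.sub_apply]
    refine add_nonneg (Int.natCast_nonneg _) (Finset.sum_nonneg fun a _ => ?_)
    have := chi_nonneg (B a) e
    simpa [chi, he] using this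
  let h : E → ℤ := fun e => residualSign U e * g e
  have hsh : ∀ e, residualSign U e * h e = g e := fun e => by
    simp only [h, ← mul_assoc, residualSign_mul_self, one_mul]
  have hh : (G.residual U).IsFlow s t h 1 := by
    rw [isFlow_residual_iff]
    simpa only [hsh] using hg
  have hh0 : ∀ e, 0 ≤ h e := by
    intro e
    simp only [h, residualSign]
    split_ifs with he
    · linarith [hgU e he]
    · linarith [hgU' e he]
  obtain ⟨q, hq, hqh⟩ := hh.exists_isPath hh0 one_pos
  have hcirc := residual_circulation_cost_nonneg hU hx hmin
    (h := h - fun e => (q.count e : ℤ)) (by simpa using hh.sub hq.1.isFlow)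
    (fun e => sub_nonneg.2 (hq.count_le hh0 hqh e))
  obtain ⟨A, hA, hAx⟩ := exists_augmentation (m := 1) hU hx (by simpa using hq.1.isFlow)
    (fun e => Int.natCast_nonneg _) hq.count_le_one
  refine ⟨A, hA, ?_⟩
  have hsplit : ∑ e, x e * (residualSign U e * (h - fun e => (q.count e : ℤ)) e : ℤ) =
      ∑ e, x e * (g e : ℝ) - ∑ e, x e * (residualSign U e * (q.count e : ℤ) : ℤ) := by
    rw [← Finset.sum_sub_distrib]
    refine Finset.sum_congr rfl fun e _ => ?_
    rw [← hsh e]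
    simp only [Pi.sub_apply]
    push_cast
    ring
  have hk0 : (0 : ℝ) ≤ k := Nat.cast_nonneg k
  have hle : ∑ e ∈ A, x e ≤ ∑ e ∈ U, x e + ∑ e, x e * ((P i).count e : ℝ) := by linarith
  have := mul_le_mul_of_nonneg_left hle hk0
  linarith

/-- The benchmark: some union of `k + 1` edge-disjoint paths costs at most `(k + 1) / k` times the
bids of the cheapest feasible set. -/
theorem exists_mem_pathUnions_le_of_nuConstraints {s t : V} {k : ℕ} (hk : 1 ≤ k) {c b : E → ℝ≥0}
    {S : Finset E} (hS : S ∈ G.kPathsSystem s t k)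
    (hb : NuConstraints (G.kPathsSystem s t k) c S b) :
    ∃ A ∈ G.pathUnions s t (k + 1),
      k * ∑ e ∈ A, (c e : ℝ) ≤ (k + 1) * ∑ e ∈ S, (b e : ℝ) := by
  obtain ⟨U, hU, hUS⟩ := exists_subset_mem_pathUnions hS
  have hUF := mem_kPathsSystem_of_subset hU subset_rfl
  let y : E → ℝ≥0 := fun e => if e ∈ S then b e else c e
  have hy : ∀ T : Finset E, ∑ e ∈ T, y e = ∑ e ∈ S ∩ T, b e + ∑ e ∈ T \ S, c e := by
    intro T
    rw [← Finset.sum_inter_add_sum_sdiff T S, Finset.inter_comm T S]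
    congr 1
    · exact Finset.sum_congr rfl fun e he => if_pos (Finset.mem_inter.1 he).1
    · exact Finset.sum_congr rfl fun e he => if_neg (Finset.mem_sdiff.1 he).2
  have hSsum : ∀ T : Finset E, ∑ e ∈ S, b e = ∑ e ∈ S ∩ T, b e + ∑ e ∈ S \ T, b e := fun T =>
    (Finset.sum_inter_add_sum_sdiff S T _).symm
  have hlow : ∀ T ∈ G.kPathsSystem s t k, ∑ e ∈ S, b e ≤ ∑ e ∈ T, y e := by
    intro T hT
    rw [hy, hSsum T]
    gcongr
    exact hb.no_cheaper T hT
  have hyS : ∑ e ∈ S, y e = ∑ e ∈ S, b e := by simp [hy]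
  have hUsum : ∑ e ∈ U, y e = ∑ e ∈ S, b e :=
    le_antisymm (hyS ▸ Finset.sum_le_sum_of_subset hUS) (hlow U hUF)
  obtain ⟨A, hA, hAk⟩ := exists_mem_pathUnions_succ hk hU (x := fun e => (y e : ℝ))
    (fun e => (y e).coe_nonneg)
    (fun T hT => by
      have := hlow T (mem_kPathsSystem_of_subset hT subset_rfl)
      rw [← hUsum] at this
      exact_mod_cast this)
    (fun e he => by
      obtain ⟨T, hT, heT, htight⟩ := hb.tight e (hUS he)
      obtain ⟨B, hB, hBT⟩ := exists_subset_mem_pathUnions hT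
      refine ⟨B, hB, fun h => heT (hBT h), ?_⟩
      have h1 : ∑ e ∈ T, y e = ∑ e ∈ S, b e := by rw [hy, hSsum T, htight]
      have h2 : ∑ e ∈ B, y e = ∑ e ∈ U, y e := by
        rw [hUsum]
        exact le_antisymm (h1 ▸ Finset.sum_le_sum_of_subset hBT)
          (hlow B (mem_kPathsSystem_of_subset hB subset_rfl))
      exact_mod_cast h2)
  refine ⟨A, hA, ?_⟩
  have h1 : ∑ e ∈ U, (y e : ℝ) = ∑ e ∈ S, (b e : ℝ) := by exact_mod_cast hUsum
  rw [h1] at hAk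
  refine le_trans (mul_le_mul_of_nonneg_left (Finset.sum_le_sum fun e _ => ?_)
    (Nat.cast_nonneg k)) hAk
  simp only [y]
  split_ifs
  · exact_mod_cast hb.cost_le e
  · exact le_rfl

end DiMultigraph

theorem mainTheorem3 {V E : Type*} [Fintype E] [DecidableEq E] (G : DiMultigraph V E) (s t : V)
    (hst : s ≠ t) (k : ℕ) (hk : 1 ≤ k) (M : PruningLiftingKPaths G s t k) :
    frugalityRatio (G.kPathsSystem s t k) M.toMechanism ≤
      ENNReal.ofReal (G.alphaSucc s t k * ((k + 1) / k)) := by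
  refine iSup_le fun c => iSup₂_le fun S hS => ENNReal.div_le_of_le_mul ?_
  have hk0 : (0 : ℝ) < k := by exact_mod_cast hk
  have hpay := M.totalPayment_le c
  rcases le_or_gt (G.alphaSucc s t k) 0 with hα | hα
  · rw [ENNReal.ofReal_of_nonpos (mul_nonpos_of_nonpos_of_nonneg hα
      (Finset.sum_nonneg fun e _ => (c e).coe_nonneg))] at hpay
    exact hpay.trans zero_le
  have hK : ENNReal.ofReal (G.alphaSucc s t k * ((k + 1) / k)) ≠ 0 := by
    rw [Ne, ENNReal.ofReal_eq_zero, not_le]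
    positivity
  rw [nu, ENNReal.mul_iInf_of_ne hK ENNReal.ofReal_ne_top]
  refine le_iInf fun b => ?_
  rw [ENNReal.mul_iInf_of_ne hK ENNReal.ofReal_ne_top]
  refine le_iInf fun hb => hpay.trans ?_
  obtain ⟨A, hA, hAk⟩ := DiMultigraph.exists_mem_pathUnions_le_of_nuConstraints hk hS.1 hb
  have hcA : ∑ e ∈ M.prune c, (c e : ℝ) ≤ ∑ e ∈ A, (c e : ℝ) := by
    exact_mod_cast M.prune_min c A hA
  rw [← ENNReal.ofReal_coe_nnreal, ← ENNReal.ofReal_mul (by positivity)]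
  refine ENNReal.ofReal_le_ofReal ?_
  rw [mul_assoc, NNReal.coe_sum]
  refine mul_le_mul_of_nonneg_left (hcA.trans ?_) hα.le
  rw [div_mul_eq_mul_div, le_div_iff₀' hk0]
  exact hAk
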